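/- Let $H$ be a separable infinite-dimensional complex Hilbert space. Let $\mathcal{I}^{\mathrm{cont}}$ be the set of all isometric $C_0$-semigroups $T(\cdot)=(T(t))_{t\ge 0}$ on $H$, endowed with the topology of strong convergence uniform on compact time intervals in $\mathbb{R}_+=[0,\infty)$ (that is, $T_\alpha\to T$ if and only if $\sup_{t\in[0,a]}\|T_\alpha(t)x-T(t)x\|\to 0$ for all $x\in H$ and $a>0$). Then the set of rigid semigroups $$\{T(\cdot)\in\mathcal{I}^{\mathrm{cont}} : \text{there are } t_j\ge 0,\ t_j\to\infty,\ \text{with } \lim_{j\to\infty}T(t_j)x=x \text{ for all } x\in H\}$$ is residual in $\mathcal{I}^{\mathrm{cont}}$, i.e. it contains a countable intersection of dense open subsets of $\mathcal{I}^{\mathrm{cont}}$. The same holds for unitary $C_0$-groups: let $\mathcal{U}^{\mathrm{cont}}$ be the set of all unitary $C_0$-groups $U(\cdot)=(U(t))_{t\in\mathbb{R}}$ on $H$, endowed with the topology of strong convergence uniform on compact time intervals in $\mathbb{R}$. Then the set $$\{U(\cdot)\in\mathcal{U}^{\mathrm{cont}} : \text{there are } t_j\ge 0,\ t_j\to\infty,\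 \text{with } \lim_{j\to\infty}U(t_j)x=x \text{ for all } x\in H\}$$ is residual in $\mathcal{U}^{\mathrm{cont}}$. -/

import Mathlib

open Filter Topology
open scoped NNReal

/-- A `C₀`-semigroup (strongly continuous one-parameter semigroup) of bounded operators on a
complex normed space, indexed by `[0, ∞)`. -/
structure C0Semigroup (X : Type*) [NormedAddCommGroup X] [NormedSpace ℂ X] where
  toFun : ℝ≥0 → X →L[ℂ] X
  map_zero' : toFun 0 = ContinuousLinearMap.id ℂ X
  map_add' : ∀ s t : ℝ≥0, toFun (s + t) = (toFun s).comp (toFun t)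
  continuous_orbit : ∀ x : X, Continuous fun t : ℝ≥0 => toFun t x

/-- A `C₀`-group (strongly continuous one-parameter group) of bounded operators on a complex
normed space, indexed by `ℝ`. -/
structure C0Group (X : Type*) [NormedAddCommGroup X] [NormedSpace ℂ X] where
  toFun : ℝ → X →L[ℂ] X
  map_zero' : toFun 0 = ContinuousLinearMap.id ℂ X
  map_add' : ∀ s t : ℝ, toFun (s + t) = (toFun s).comp (toFun t)
  continuous_orbit : ∀ x : X, Continuous fun t : ℝ => toFun t x

namespace C0Semigroup

variable {X : Type*} [NormedAddCommGroup X] [NormedSpace ℂ X]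

/-- The orbit `t ↦ T(t) x` as a continuous map. -/
def orbit (T : C0Semigroup X) (x : X) : C(ℝ≥0, X) :=
  ⟨fun t => T.toFun t x, T.continuous_orbit x⟩

/-- The topology of strong convergence uniform on compact time intervals in `[0, ∞)`: the initial
topology for the maps `T ↦ T(·) x`, `x ∈ X`, where `C([0, ∞), X)` carries the topology of uniform
convergence on compact sets. -/
instance : TopologicalSpace (C0Semigroup X) :=
  TopologicalSpace.induced orbit inferInstance

/-- A semigroup is rigid if `T(t_j) → I` strongly for some sequence `t_j → ∞`. -/
def IsRigid (T : C0Semigroup X) : Prop :=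
  ∃ t : ℕ → ℝ≥0, Tendsto t atTop atTop ∧
    ∀ x : X, Tendsto (fun j => T.toFun (t j) x) atTop (𝓝 x)

/-- A semigroup is isometric if every `T(t)` is an isometry. -/
def IsIsometric (T : C0Semigroup X) : Prop :=
  ∀ t : ℝ≥0, Isometry (T.toFun t)

/-- Convergence in the topology above is uniform convergence of all orbits on all compact time
intervals. -/
theorem tendsto_nhds_iff {ι : Type*} {l : Filter ι} {F : ι → C0Semigroup X} {T : C0Semigroup X} :
    Tendsto F l (𝓝 T) ↔ ∀ (x : X) (a : ℝ≥0),
      TendstoUniformlyOn (fun i t => (F i).toFun t x) (fun t => T.toFun t x) l (Set.Icc 0 a) := by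
  rw [nhds_induced, tendsto_comap_iff, tendsto_pi_nhds]
  refine forall_congr' fun x => ?_
  rw [ContinuousMap.tendsto_iff_forall_isCompact_tendstoUniformlyOn]
  constructor
  · exact fun h a => h _ isCompact_Icc
  · intro h K hK
    obtain ⟨a, ha⟩ := hK.bddAbove
    exact (h a).mono fun t ht => ⟨zero_le, ha ht⟩

end C0Semigroup

namespace C0Group

variable {X : Type*} [NormedAddCommGroup X] [NormedSpace ℂ X]

/-- The orbit `t ↦ U(t) x` as a continuous map. -/
def orbit (U : C0Group X) (x : X) : C(ℝ, X) :=
  ⟨fun t => U.toFun t x, U.continuous_orbit x⟩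

/-- The topology of strong convergence uniform on compact time intervals in `ℝ`. -/
instance : TopologicalSpace (C0Group X) :=
  TopologicalSpace.induced orbit inferInstance

/-- The semigroup `(U(t))`, `t ≥ 0`, of a `C₀`-group. -/
def toC0Semigroup (U : C0Group X) : C0Semigroup X where
  toFun t := U.toFun t
  map_zero' := U.map_zero'
  map_add' s t := U.map_add' s t
  continuous_orbit x := (U.continuous_orbit x).comp NNReal.continuous_coe

/-- A group is rigid if `U(t_j) → I` strongly for some sequence `t_j → +∞`. -/
def IsRigid (U : C0Group X) : Prop :=
  U.toC0Semigroup.IsRigid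

/-- Convergence in the topology above is uniform convergence of all orbits on all compact time
intervals. -/
theorem tendsto_nhds_iff {ι : Type*} {l : Filter ι} {F : ι → C0Group X} {U : C0Group X} :
    Tendsto F l (𝓝 U) ↔ ∀ (x : X) (a b : ℝ),
      TendstoUniformlyOn (fun i t => (F i).toFun t x) (fun t => U.toFun t x) l (Set.Icc a b) := by
  rw [nhds_induced, tendsto_comap_iff, tendsto_pi_nhds]
  refine forall_congr' fun x => ?_
  rw [ContinuousMap.tendsto_iff_forall_isCompact_tendstoUniformlyOn]
  constructor
  · exact fun h a b => h _ isCompact_Icc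
  · intro h K hK
    obtain ⟨a, ha⟩ := hK.bddBelow
    obtain ⟨b, hb⟩ := hK.bddAbove
    exact (h a b).mono fun t ht => ⟨ha ht, hb ht⟩

end C0Group

/-- A `C₀`-group on a Hilbert space is unitary if every `U(t)` is a unitary operator. -/
def C0Group.IsUnitary {H : Type*} [NormedAddCommGroup H] [InnerProductSpace ℂ H] [CompleteSpace H]
    (U : C0Group H) : Prop :=
  ∀ t : ℝ, U.toFun t ∈ unitary (H →L[ℂ] H)

/-- The space of all isometric `C₀`-semigroups on `H`, with the subspace topology (strong
convergence uniform on compact time intervals in `[0, ∞)`). -/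
abbrev IsometricC0Semigroup (H : Type*) [NormedAddCommGroup H] [InnerProductSpace ℂ H] : Type _ :=
  {T : C0Semigroup H // T.IsIsometric}

/-- The space of all unitary `C₀`-groups on `H`, with the subspace topology (strong convergence
uniform on compact time intervals in `ℝ`; since `U(t)* = U(-t)`, this includes convergence of the
adjoints). -/
abbrev UnitaryC0Group (H : Type*) [NormedAddCommGroup H] [InnerProductSpace ℂ H]
    [CompleteSpace H] : Type _ :=
  {U : C0Group H // U.IsUnitary}

section

variable {H : Type*} [NormedAddCommGroup H] [InnerProductSpace ℂ H] [CompleteSpace H]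

/-! Fix a dense sequence `x`. Returning at some time `t ≥ n` within `1 / (n + 1)` on `x 0, …, x n`
is an open condition, and an isometric semigroup that satisfies it for all `n` is rigid. What
remains is density of each condition.

Density: every isometric semigroup is a limit of groups `exp (t • B)` with `B` skew-adjoint of
finite rank. Such groups are recurrent: they are trivial off a finite-dimensional space and have
relatively compact orbits on it. To find `B`, note that `T(h)* T(h) = 1`, so `T(h)*` acts on orbits
almost as the backward shift, and `(T(h) - T(h)*) / 2h` is close to the generator along smooth
orbits, uniformly in time (`norm_generator_sub_skewQuotient_le`). Compactness of orbit segments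
permits a finite-dimensional compression, and Duhamel's estimate (`norm_exp_smul_sub_le`) compares
the flows. The approximants are unitary, so they also serve for unitary groups, after a time shift.
-/

theorem norm_apply_of_mem_unitary {u : H →L[ℂ] H} (hu : u ∈ unitary (H →L[ℂ] H)) (x : H) :
    ‖u x‖ = ‖x‖ :=
  ContinuousLinearMap.norm_map_of_mem_unitary hu x

/-! ### Groups with bounded skew-adjoint generator -/

theorem hasDerivAt_exp_smul_apply (B : H →L[ℂ] H) (x : H) (t : ℝ) :
    HasDerivAt (fun s : ℝ => NormedSpace.exp (s • B) x) (NormedSpace.exp (t • B) (B x)) t := by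
  have h := hasDerivAt_exp_smul_const (𝕂 := ℝ) B t
  exact ((ContinuousLinearMap.apply ℂ H x).restrictScalars ℝ).hasFDerivAt.comp_hasDerivAt t h

theorem smul_mem_skewAdjoint_real {B : H →L[ℂ] H} (hB : B ∈ skewAdjoint (H →L[ℂ] H)) (t : ℝ) :
    t • B ∈ skewAdjoint (H →L[ℂ] H) :=
  skewAdjoint.smul_mem t hB

theorem exp_smul_mem_unitary {B : H →L[ℂ] H} (hB : B ∈ skewAdjoint (H →L[ℂ] H)) (t : ℝ) :
    NormedSpace.exp (t • B) ∈ unitary (H →L[ℂ] H) := by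
  let +nondep : NormedAlgebra ℚ (H →L[ℂ] H) := .restrictScalars ℚ ℂ _
  exact NormedSpace.exp_mem_unitary_of_mem_skewAdjoint (smul_mem_skewAdjoint_real hB t)

/-- The uniformly continuous group generated by a bounded operator. -/
noncomputable def C0Group.ofBounded (B : H →L[ℂ] H) : C0Group H where
  toFun t := NormedSpace.exp (t • B)
  map_zero' := by simp [NormedSpace.exp_zero]; rfl
  map_add' s t := by
    let +nondep : NormedAlgebra ℚ (H →L[ℂ] H) := .restrictScalars ℚ ℂ _
    rw [add_smul]
    exact NormedSpace.exp_add_of_commute (((Commute.refl B).smul_left s).smul_right t)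
  continuous_orbit x :=
    continuous_iff_continuousAt.2 fun t => (hasDerivAt_exp_smul_apply B x t).continuousAt

theorem C0Group.isUnitary_ofBounded {B : H →L[ℂ] H} (hB : B ∈ skewAdjoint (H →L[ℂ] H)) :
    (C0Group.ofBounded B).IsUnitary :=
  exp_smul_mem_unitary hB

theorem C0Group.IsUnitary.isIsometric {U : C0Group H} (hU : U.IsUnitary) :
    U.toC0Semigroup.IsIsometric := fun t =>
  AddMonoidHomClass.isometry_of_norm _ (norm_apply_of_mem_unitary (hU t))

/-- The compression of a skew-adjoint operator to a closed subspace is skew-adjoint. -/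
theorem compression_mem_skewAdjoint {A : H →L[ℂ] H} (hA : A ∈ skewAdjoint (H →L[ℂ] H))
    (V : Submodule ℂ H) [V.HasOrthogonalProjection] :
    V.starProjection * A * V.starProjection ∈ skewAdjoint (H →L[ℂ] H) := by
  rw [skewAdjoint.mem_iff] at hA ⊢
  have hP : star V.starProjection = V.starProjection := isSelfAdjoint_starProjection V
  simp [hA, hP, mul_assoc]

omit [CompleteSpace H] in
/-- On a compact set, a bounded operator is uniformly close to a compression to a
finite-dimensional subspace. -/
theorem exists_finiteDimensional_compression_near {K : Set H} (hK : IsCompact K)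
    (A : H →L[ℂ] H) {ε : ℝ} (hε : 0 < ε) :
    ∃ V : Submodule ℂ H, ∃ _ : FiniteDimensional ℂ V,
      ∀ y ∈ K, ‖A y - (V.starProjection * A * V.starProjection) y‖ ≤ ε := by
  set δ : ℝ := ε / (2 * ‖A‖ + 1)
  have hδ : 0 < δ := by positivity
  obtain ⟨t, htf, htK⟩ := Metric.totallyBounded_iff.1 hK.totallyBounded δ hδ
  -- The span contains a `δ`-net and its image under `A`, so the compression agrees with `A` on the
  -- net.
  have hfin : (t ∪ A '' t).Finite := htf.union (htf.image A)
  have := FiniteDimensional.span_of_finite ℂ hfin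
  refine ⟨Submodule.span ℂ (t ∪ A '' t), this, fun y hy => ?_⟩
  set V := Submodule.span ℂ (t ∪ A '' t)
  obtain ⟨z, hz, hyz⟩ : ∃ z ∈ t, dist y z < δ := by simpa using htK hy
  have hzV : V.starProjection z = z :=
    Submodule.starProjection_eq_self_iff.2 (Submodule.subset_span (Or.inl hz))
  have hAzV : V.starProjection (A z) = A z :=
    Submodule.starProjection_eq_self_iff.2
      (Submodule.subset_span (Or.inr (Set.mem_image_of_mem _ hz)))
  have hEq : A y - (V.starProjection * A * V.starProjection) y
      = A (y - z) - V.starProjection (A (V.starProjection (y - z))) := by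
    simp [hzV, hAzV]
  rw [dist_eq_norm] at hyz
  have h1 : ‖A (y - z)‖ ≤ ‖A‖ * δ :=
    (A.le_opNorm _).trans (by gcongr)
  have h2 : ‖V.starProjection (A (V.starProjection (y - z)))‖ ≤ ‖A‖ * δ := by
    refine (V.norm_starProjection_apply_le _).trans ((A.le_opNorm _).trans ?_)
    gcongr
    exact (V.norm_starProjection_apply_le _).trans hyz.le
  rw [hEq]
  calc _ ≤ ‖A‖ * δ + ‖A‖ * δ := (norm_sub_le _ _).trans (add_le_add h1 h2)
    _ ≤ (2 * ‖A‖ + 1) * δ := by nlinarith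
    _ = ε := by simp only [δ]; field_simp

/-- Duhamel estimate: an approximate solution of `u' = B u`, `B` skew-adjoint, is close to the
exact one. -/
theorem norm_exp_smul_sub_le {B : H →L[ℂ] H} (hB : B ∈ skewAdjoint (H →L[ℂ] H)) {u u' : ℝ → H}
    (hc : Continuous u) (hu : ∀ s, 0 ≤ s → HasDerivWithinAt u (u' s) (Set.Ici s) s)
    {c ε : ℝ} (hε : ∀ s ∈ Set.Icc 0 c, ‖u' s - B (u s)‖ ≤ ε) {t : ℝ} (ht : t ∈ Set.Icc 0 c) :
    ‖NormedSpace.exp (t • B) (u 0) - u t‖ ≤ ε * t := by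
  have hinv : ∀ s : ℝ, ∀ x : H, NormedSpace.exp (s • B) (NormedSpace.exp ((-s) • B) x) = x := by
    intro s x
    have := (C0Group.ofBounded B).map_add' s (-s)
    rw [add_neg_cancel, (C0Group.ofBounded B).map_zero'] at this
    exact (DFunLike.congr_fun this x).symm
  set F : ℝ → H →L[ℂ] H := fun s => NormedSpace.exp ((-s) • B)
  have hF : ∀ s, HasDerivAt F (-(F s * B)) s := by
    intro s
    have h := (hasDerivAt_exp_smul_const (𝕂 := ℝ) B (-s)).scomp s (hasDerivAt_neg s)
    simpa [F, Function.comp_def] using h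
  have hFc : Continuous F := continuous_iff_continuousAt.2 fun s => (hF s).continuousAt
  -- In the derivative of `exp (-s • B) (u s)` only the defect `u' s - B (u s)` survives, and the
  -- unitary factor preserves its norm.
  have hder : ∀ s ∈ Set.Ico 0 c, HasDerivWithinAt (fun s => F s (u s))
      (F s (u' s - B (u s))) (Set.Ici s) s := by
    intro s hs
    have h := ((ContinuousLinearMap.restrictScalarsL ℂ H H ℝ ℝ).hasFDerivAt.comp_hasDerivAt s
      (hF s)).hasDerivWithinAt (s := Set.Ici s)
    have h2 := h.clm_apply (hu s hs.1)
    refine h2.congr_deriv ?_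
    change -(F s (B (u s))) + F s (u' s) = F s (u' s - B (u s))
    rw [map_sub]; abel
  have key := norm_image_sub_le_of_norm_deriv_right_le_segment (C := ε)
    ((hFc.clm_apply hc).continuousOn) hder (fun s hs => by
      rw [norm_apply_of_mem_unitary (exp_smul_mem_unitary hB _)]
      exact hε s (Set.Ico_subset_Icc_self hs)) t ht
  have h0 : F 0 (u 0) = u 0 := by simp [F, NormedSpace.exp_zero]
  rw [h0, sub_zero, ← norm_apply_of_mem_unitary (exp_smul_mem_unitary hB t), map_sub, hinv,
    norm_sub_rev] at key
  exact key

/-! ### Finite-rank approximation of isometric semigroups -/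

namespace C0Semigroup

omit [CompleteSpace H] in
theorem IsIsometric.norm_map {T : C0Semigroup H} (hT : T.IsIsometric) (t : ℝ≥0) (x : H) :
    ‖T.toFun t x‖ = ‖x‖ :=
  AddMonoidHomClass.isometry_iff_norm _ |>.1 (hT t) x

omit [CompleteSpace H] in
theorem map_add_apply (T : C0Semigroup H) (s t : ℝ≥0) (x : H) :
    T.toFun (s + t) x = T.toFun s (T.toFun t x) := by
  rw [T.map_add']; rfl

omit [CompleteSpace H] in
theorem map_zero_apply (T : C0Semigroup H) (x : H) : T.toFun 0 x = x := by
  rw [T.map_zero']; rfl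

omit [CompleteSpace H] in
theorem continuous_orbit_toNNReal (T : C0Semigroup H) (x : H) :
    Continuous fun s : ℝ => T.toFun s.toNNReal x :=
  (T.continuous_orbit x).comp continuous_real_toNNReal

/-- The orbit of `x` is continuously (right) differentiable, with derivative the orbit of `g`;
that is, `x` is in the domain of the generator and `g` is its image. -/
def HasGenerator (T : C0Semigroup H) (x g : H) : Prop :=
  ∀ s : ℝ, 0 ≤ s → HasDerivWithinAt (fun s : ℝ => T.toFun s.toNNReal x)
    (T.toFun s.toNNReal g) (Set.Ici s) s

/-- The domain of the generator is dense. -/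
theorem exists_hasGenerator_near (T : C0Semigroup H) (z : H) {ε : ℝ} (hε : 0 < ε) :
    ∃ x g : H, ‖x - z‖ < ε ∧ T.HasGenerator x g := by
  set o : ℝ → H := fun s => T.toFun s.toNNReal z
  have ho : Continuous o := T.continuous_orbit_toNNReal z
  set E : ℝ → H := fun s => ∫ u in (0 : ℝ)..s, o u
  have hE : ∀ s, HasDerivAt E (o s) s := fun s =>
    intervalIntegral.integral_hasDerivAt_right (ho.intervalIntegrable _ _)
      (ho.stronglyMeasurableAtFilter _ _) ho.continuousAt
  have hmap : ∀ d : ℝ, 0 ≤ d → ∀ s : ℝ, 0 ≤ s →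
      T.toFun s.toNNReal (E d) = E (s + d) - E s := by
    intro d hd s hs
    have h1 : E (s + d) - E s = ∫ u in s..(s + d), o u :=
      intervalIntegral.integral_interval_sub_left (ho.intervalIntegrable _ _)
        (ho.intervalIntegrable _ _)
    rw [h1, ← ContinuousLinearMap.intervalIntegral_comp_comm _ (ho.intervalIntegrable _ _)]
    have h2 : ∫ u in (0 : ℝ)..d, T.toFun s.toNNReal (o u) = ∫ u in (0 : ℝ)..d, o (s + u) := by
      refine intervalIntegral.integral_congr fun u hu => ?_
      rw [Set.uIcc_of_le hd] at hu
      simp only [o]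
      rw [Real.toNNReal_add hs hu.1, map_add_apply]
    rw [h2, intervalIntegral.integral_comp_add_left, add_zero]
  have hlim : Tendsto (fun d : ℝ => d⁻¹ • E d) (𝓝[>] 0) (𝓝 z) := by
    have h := (hE 0).tendsto_slope_zero_right
    have hE0 : E 0 = 0 := by simp [E]
    have ho0 : o 0 = z := by simp [o, map_zero_apply]
    simpa [hE0, ho0] using h
  obtain ⟨d, hd, hd0⟩ := ((hlim.eventually (Metric.ball_mem_nhds z hε)).and
    self_mem_nhdsWithin).exists
  have hd0 : 0 < d := hd0
  -- The vector is the orbit's average over `[0, d]`; differentiating the shifted integral leaves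
  -- only the endpoint values.
  refine ⟨d⁻¹ • E d, d⁻¹ • (o d - z), mem_ball_iff_norm.1 hd, fun s hs => ?_⟩
  have hD : HasDerivAt (fun s => d⁻¹ • (E (s + d) - E s)) (d⁻¹ • (o (s + d) - o s)) s :=
    (((hE (s + d)).comp_add_const s d).sub (hE s)).const_smul d⁻¹
  have hg : T.toFun s.toNNReal (d⁻¹ • (o d - z)) = d⁻¹ • (o (s + d) - o s) := by
    rw [ContinuousLinearMap.map_smul_of_tower, map_sub]
    simp only [o]
    rw [Real.toNNReal_add hs hd0.le, map_add_apply]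
  rw [hg]
  refine hD.hasDerivWithinAt.congr_of_mem (fun r hr => ?_) Set.self_mem_Ici
  have hr : 0 ≤ r := hs.trans hr
  rw [ContinuousLinearMap.map_smul_of_tower, hmap d hd0.le r hr]

/-- The bounded skew-adjoint operator `(T(h) - T(h)*) / 2h`, approximating the generator. -/
noncomputable def skewQuotient (T : C0Semigroup H) (h : ℝ) : H →L[ℂ] H :=
  (2 * h)⁻¹ • (T.toFun h.toNNReal - star (T.toFun h.toNNReal))

theorem skewQuotient_mem_skewAdjoint (T : C0Semigroup H) (h : ℝ) :
    T.skewQuotient h ∈ skewAdjoint (H →L[ℂ] H) := by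
  refine smul_mem_skewAdjoint_real ?_ _
  rw [skewAdjoint.mem_iff, star_sub, star_star, neg_sub]

theorem IsIsometric.star_map_map {T : C0Semigroup H} (hT : T.IsIsometric) (t : ℝ≥0) (x : H) :
    star (T.toFun t) (T.toFun t x) = x := by
  have h := (ContinuousLinearMap.norm_map_iff_adjoint_comp_self (T.toFun t)).1 (hT.norm_map t)
  exact DFunLike.congr_fun h x

theorem IsIsometric.norm_star_le {T : C0Semigroup H} (hT : T.IsIsometric) (t : ℝ≥0) (x : H) :
    ‖star (T.toFun t) x‖ ≤ ‖x‖ := by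
  have h1 : ‖T.toFun t‖ ≤ 1 :=
    ContinuousLinearMap.opNorm_le_bound _ zero_le_one fun y => by rw [hT.norm_map, one_mul]
  calc _ ≤ ‖star (T.toFun t)‖ * ‖x‖ := ContinuousLinearMap.le_opNorm _ _
    _ ≤ 1 * ‖x‖ := by rw [norm_star]; gcongr
    _ = ‖x‖ := one_mul _

/-- Along an orbit, the error between the generator and its skew-adjoint approximation is bounded
independently of time. -/
theorem IsIsometric.norm_generator_sub_skewQuotient_le {T : C0Semigroup H} (hT : T.IsIsometric)
    {h : ℝ} (hh : 0 < h) (x g : H) (s : ℝ≥0) :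
    ‖T.toFun s g - T.skewQuotient h (T.toFun s x)‖ ≤
      ‖h⁻¹ • (T.toFun h.toNNReal x - x) - g‖ + ‖T.toFun h.toNNReal g - g‖ := by
  set τ := h.toNNReal
  have hcomm : ∀ y, T.toFun τ (T.toFun s y) = T.toFun s (T.toFun τ y) := fun y => by
    rw [← map_add_apply, add_comm, map_add_apply]
  set e : H := h⁻¹ • (T.toFun τ x - x) - g
  set f : H := T.toFun τ g - g
  have he : h⁻¹ • (T.toFun τ x - x) = g + e := by simp [e]
  have hxe : T.toFun τ x - x = h • (g + e) := by
    rw [← he, smul_smul, mul_inv_cancel₀ hh.ne', one_smul]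
  have hTx : T.toFun τ (T.toFun s x) = T.toFun s x + h • T.toFun s (g + e) := by
    rw [hcomm, ← ContinuousLinearMap.map_smul_of_tower, ← hxe, map_sub]; abel
  -- `T(τ)*` is a left inverse of `T(τ)`; applying it to `hTx` gives a backward difference even when
  -- `s < τ`.
  have hSx : star (T.toFun τ) (T.toFun s x)
      = T.toFun s x - h • star (T.toFun τ) (T.toFun s (g + e)) := by
    have h1 := congrArg (⇑(star (T.toFun τ))) hTx
    rw [hT.star_map_map, map_add, ContinuousLinearMap.map_smul_of_tower] at h1
    rw [eq_sub_iff_add_eq]; exact h1.symm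
  have hSg : star (T.toFun τ) (T.toFun s g)
      = T.toFun s g - star (T.toFun τ) (T.toFun s f) := by
    have h1 : T.toFun τ (T.toFun s g) = T.toFun s g + T.toFun s f := by
      rw [hcomm, ← map_add]; simp [f]
    have h2 := congrArg (⇑(star (T.toFun τ))) h1
    rw [hT.star_map_map, map_add] at h2
    rw [eq_sub_iff_add_eq]; exact h2.symm
  have hq : T.skewQuotient h (T.toFun s x)
      = (2 : ℝ)⁻¹ • (T.toFun s (g + e) + star (T.toFun τ) (T.toFun s (g + e))) := by
    have : T.skewQuotient h (T.toFun s x) = (2 * h)⁻¹ •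
      (T.toFun τ (T.toFun s x) - star (T.toFun τ) (T.toFun s x)) := rfl
    rw [this, hTx, hSx, add_sub_sub_cancel, ← smul_add, smul_smul, mul_inv, mul_assoc,
      inv_mul_cancel₀ hh.ne', mul_one]
  -- Only defects at time zero, transported by contractions, remain: the norm is at most `(‖f‖ +
  -- 2‖e‖) / 2`.
  have hmain : T.toFun s g - T.skewQuotient h (T.toFun s x) =
      (2 : ℝ)⁻¹ • (star (T.toFun τ) (T.toFun s f) - T.toFun s e
        - star (T.toFun τ) (T.toFun s e)) := by
    rw [hq, map_add, map_add, hSg]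
    module
  have n1 : ‖star (T.toFun τ) (T.toFun s f)‖ ≤ ‖f‖ :=
    (hT.norm_star_le _ _).trans (hT.norm_map _ _).le
  have n2 : ‖star (T.toFun τ) (T.toFun s e)‖ ≤ ‖e‖ :=
    (hT.norm_star_le _ _).trans (hT.norm_map _ _).le
  have n3 := hT.norm_map s e
  have n4 := norm_sub_le (star (T.toFun τ) (T.toFun s f) - T.toFun s e)
    (star (T.toFun τ) (T.toFun s e))
  have n5 := norm_sub_le (star (T.toFun τ) (T.toFun s f)) (T.toFun s e)
  rw [hmain, norm_smul, Real.norm_of_nonneg (by norm_num)]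
  linarith [norm_nonneg f]

/-- Isometric semigroups are approximated, on finitely many vectors and uniformly on compact
intervals, by the unitary groups generated by finite-dimensional compressions of bounded
skew-adjoint operators. -/
theorem IsIsometric.exists_compression_near {T : C0Semigroup H} (hT : T.IsIsometric)
    (F : Finset H) (c : ℝ≥0) {ε : ℝ} (hε : 0 < ε) :
    ∃ A ∈ skewAdjoint (H →L[ℂ] H), ∃ V : Submodule ℂ H, ∃ _ : FiniteDimensional ℂ V,
      ∀ z ∈ F, ∀ t ≤ c, ‖NormedSpace.exp ((t : ℝ) • (V.starProjection * A * V.starProjection)) z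
        - T.toFun t z‖ < ε := by
  choose x g hxz hxg using fun z => T.exists_hasGenerator_near z (ε := ε / 4) (by positivity)
  -- The quotient and the compression each cost `δ`, so Duhamel gives `2 * δ * t ≤ ε / 4`; replacing
  -- `z` by `x z` costs `ε / 4` twice.
  set δ : ℝ := ε / (8 * (c + 1))
  have hδ : 0 < δ := by positivity
  have hev : ∀ z ∈ F, ∀ᶠ h in 𝓝[>] (0 : ℝ),
      ‖h⁻¹ • (T.toFun h.toNNReal (x z) - x z) - g z‖ + ‖T.toFun h.toNNReal (g z) - g z‖ < δ := by
    intro z _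
    have h1 : Tendsto (fun h : ℝ => h⁻¹ • (T.toFun h.toNNReal (x z) - x z))
        (𝓝[>] 0) (𝓝 (g z)) := by
      have := (hasDerivWithinAt_iff_tendsto_slope' (by simp)).1
        ((hxg z 0 le_rfl).mono Set.Ioi_subset_Ici_self)
      simpa [slope_fun_def, map_zero_apply] using this
    have h2 : Tendsto (fun h : ℝ => T.toFun h.toNNReal (g z)) (𝓝[>] 0) (𝓝 (g z)) := by
      have := ((T.continuous_orbit_toNNReal (g z)).tendsto 0).mono_left
        (nhdsWithin_le_nhds (s := Set.Ioi 0))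
      simpa [map_zero_apply] using this
    have h3 := (tendsto_iff_norm_sub_tendsto_zero.1 h1).add (tendsto_iff_norm_sub_tendsto_zero.1 h2)
    rw [add_zero] at h3
    exact h3.eventually_lt_const hδ
  obtain ⟨h, hhF, hh⟩ := (((Finset.eventually_all F).2 hev).and self_mem_nhdsWithin).exists
  have hh : 0 < h := hh
  have hK : IsCompact (⋃ z ∈ F, (fun s : ℝ => T.toFun s.toNNReal (x z)) '' Set.Icc 0 c) :=
    F.isCompact_biUnion fun z _ => isCompact_Icc.image (T.continuous_orbit_toNNReal (x z))
  obtain ⟨V, hV, hVK⟩ := exists_finiteDimensional_compression_near hK (T.skewQuotient h) hδ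
  have hA := T.skewQuotient_mem_skewAdjoint h
  refine ⟨T.skewQuotient h, hA, V, hV, fun z hz t ht => ?_⟩
  set B := V.starProjection * T.skewQuotient h * V.starProjection
  have hB : B ∈ skewAdjoint (H →L[ℂ] H) := compression_mem_skewAdjoint hA V
  have hd := norm_exp_smul_sub_le hB (T.continuous_orbit_toNNReal (x z)) (hxg z)
    (c := c) (ε := 2 * δ) (fun s hs => by
      have e1 := hT.norm_generator_sub_skewQuotient_le hh (x z) (g z) s.toNNReal
      have e2 := hhF z hz
      have e3 := hVK (T.toFun s.toNNReal (x z)) (Set.mem_biUnion hz ⟨s, hs, rfl⟩)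
      have e4 := norm_sub_le_norm_sub_add_norm_sub (T.toFun s.toNNReal (g z))
        (T.skewQuotient h (T.toFun s.toNNReal (x z))) (B (T.toFun s.toNNReal (x z)))
      linarith) (t := t) ⟨t.2, ht⟩
  simp only [Real.toNNReal_zero, map_zero_apply, Real.toNNReal_coe] at hd
  have hd' : 2 * δ * t ≤ ε / 4 := by
    have : (t : ℝ) ≤ c := ht
    calc 2 * δ * t ≤ 2 * δ * (c + 1) := by gcongr; linarith
      _ = ε / 4 := by simp only [δ]; field_simp; norm_num
  have a1 : ‖NormedSpace.exp ((t : ℝ) • B) z - NormedSpace.exp ((t : ℝ) • B) (x z)‖ < ε / 4 := by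
    rw [← map_sub, norm_apply_of_mem_unitary (exp_smul_mem_unitary hB _), norm_sub_rev]
    exact hxz z
  have a2 : ‖T.toFun t (x z) - T.toFun t z‖ < ε / 4 := by
    rw [← map_sub, hT.norm_map]
    exact hxz z
  have a3 := norm_sub_le_norm_sub_add_norm_sub (NormedSpace.exp ((t : ℝ) • B) z)
    (NormedSpace.exp ((t : ℝ) • B) (x z)) (T.toFun t z)
  have a4 := norm_sub_le_norm_sub_add_norm_sub (NormedSpace.exp ((t : ℝ) • B) (x z))
    (T.toFun t (x z)) (T.toFun t z)
  linarith

end C0Semigroup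

/-! ### Recurrence in finite dimensions -/

/-- The group generated by a finite-dimensional compression of a skew-adjoint operator is
recurrent. -/
theorem exists_norm_exp_smul_compression_sub_lt {A : H →L[ℂ] H}
    (hA : A ∈ skewAdjoint (H →L[ℂ] H)) (V : Submodule ℂ H) [FiniteDimensional ℂ V]
    (F : Finset H) (n : ℕ) {ε : ℝ} (hε : 0 < ε) :
    ∃ t : ℝ≥0, n ≤ t ∧ ∀ x ∈ F,
      ‖NormedSpace.exp ((t : ℝ) • (V.starProjection * A * V.starProjection)) x - x‖ < ε := by
  set P := V.starProjection
  set B := P * A * P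
  have hB : B ∈ skewAdjoint (H →L[ℂ] H) := compression_mem_skewAdjoint hA V
  set S : ℝ → H →L[ℂ] H := fun t => NormedSpace.exp (t • B)
  have hS : ∀ t x, ‖S t x‖ = ‖x‖ := fun t =>
    norm_apply_of_mem_unitary (exp_smul_mem_unitary hB t)
  have hSadd : ∀ s t x, S (s + t) x = S s (S t x) := fun s t x =>
    DFunLike.congr_fun ((C0Group.ofBounded B).map_add' s t) x
  have hPP : P * P = P := V.isIdempotentElem_starProjection
  have hcomm : ∀ t x, P (S t x) = S t (P x) := by
    intro t x
    let +nondep : NormedAlgebra ℚ (H →L[ℂ] H) := .restrictScalars ℚ ℂ _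
    have h : Commute P B := by
      change P * (P * A * P) = P * A * P * P
      rw [mul_assoc (P * A) P P, hPP, ← mul_assoc, ← mul_assoc, hPP]
    exact DFunLike.congr_fun (SemiconjBy.exp_right (h.smul_right t)) x
  have hfix : ∀ t x, S t (x - P x) = x - P x := by
    intro t x
    have hBx : B (x - P x) = 0 := by
      change P (A (P (x - P x))) = 0
      rw [map_sub, show P (P x) = P x from DFunLike.congr_fun hPP x, sub_self, map_zero, map_zero]
    have h := is_const_of_deriv_eq_zero (f := fun s : ℝ => S s (x - P x))
      (fun s => (hasDerivAt_exp_smul_apply B _ s).differentiableAt)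
      (fun s => by rw [(hasDerivAt_exp_smul_apply B _ s).deriv, hBx, map_zero]) t 0
    rw [h]
    simp [S, NormedSpace.exp_zero]
  have hmem : ∀ t x, S t (P x) ∈ V := fun t x => by
    rw [← hcomm]; exact V.starProjection_apply_mem _
  -- Sampling at multiples of `n` makes the difference of two distinct sample times at least `n`.
  set f : ℕ → F → V := fun k x => ⟨S (n * k) (P x), hmem _ _⟩
  have hbdd : ∀ k, f k ∈ Metric.closedBall (0 : F → V) (∑ x ∈ F, ‖x‖) := by
    intro k
    rw [mem_closedBall_zero_iff, pi_norm_le_iff_of_nonneg (by positivity)]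
    intro x
    change ‖S (n * k) (P x)‖ ≤ _
    rw [hS]
    exact (V.norm_starProjection_apply_le _).trans
      (Finset.single_le_sum (f := fun x : H => ‖x‖) (fun _ _ => norm_nonneg _) x.2)
  have : ProperSpace V := FiniteDimensional.proper ℂ V
  obtain ⟨a, -, φ, hφ, hlim⟩ := tendsto_subseq_of_bounded Metric.isBounded_closedBall hbdd
  obtain ⟨M, hM⟩ := Metric.cauchySeq_iff.1 hlim.cauchySeq ε hε
  have hlt : φ M < φ (M + 1) := hφ M.lt_succ_self
  obtain ⟨m, hm⟩ := Nat.exists_eq_add_of_lt hlt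
  -- The return time is `n * (φ (M + 1) - φ M)`: by isometry, two close samples yield a near return
  -- to the start.
  refine ⟨((n * (m + 1) : ℕ) : ℝ≥0), ?_, fun x hx => ?_⟩
  · exact_mod_cast Nat.le_mul_of_pos_right n m.succ_pos
  · have h1 := (dist_le_pi_dist _ _ (⟨x, hx⟩ : F)).trans_lt (hM (M + 1) (by simp) M le_rfl)
    have h2 : ‖S (n * φ (M + 1) : ℝ) (P x) - S (n * φ M) (P x)‖ < ε := by
      rw [Subtype.dist_eq, dist_eq_norm] at h1; exact h1
    have h3 : (n * φ (M + 1) : ℝ) = n * φ M + ((n * (m + 1) : ℕ) : ℝ≥0) := by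
      rw [hm]; push_cast; ring
    rw [h3, hSadd, ← map_sub, hS] at h2
    set t : ℝ := (((n * (m + 1) : ℕ) : ℝ≥0) : ℝ)
    have h4 : S t x - x = S t (P x) - P x := by
      have h5 := hfix t x
      rw [map_sub] at h5
      rw [sub_eq_sub_iff_sub_eq_sub]; exact h5
    change ‖S t x - x‖ < ε
    rwa [h4]

/-! ### Return conditions and rigidity -/

namespace C0Semigroup

omit [CompleteSpace H] in
theorem continuous_eval (t : ℝ≥0) (x : H) :
    Continuous fun T : C0Semigroup H => T.toFun t x :=
  have h : Continuous fun T : C0Semigroup H => T.orbit x :=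
    (continuous_apply (A := fun _ : H => C(ℝ≥0, H)) x).comp
      (continuous_induced_dom (f := (orbit : C0Semigroup H → H → C(ℝ≥0, H))))
  (continuous_eval_const (F := C(ℝ≥0, H)) t).comp h

/-- The semigroups which, at some time `t ≥ n`, return `1 / (n + 1)`-close to the identity on the
vectors `x 0, …, x n`. -/
def returning (x : ℕ → H) (n : ℕ) : Set (C0Semigroup H) :=
  {T | ∃ t : ℝ≥0, n ≤ t ∧ ∀ i ∈ Finset.range (n + 1), ‖T.toFun t (x i) - x i‖ < 1 / (n + 1)}

omit [CompleteSpace H] in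
theorem isOpen_returning (x : ℕ → H) (n : ℕ) : IsOpen (returning x n) := by
  have h : returning x n = ⋃ t : ℝ≥0, ⋃ _ : n ≤ t, ⋂ i ∈ Finset.range (n + 1),
      {T : C0Semigroup H | ‖T.toFun t (x i) - x i‖ < 1 / (n + 1)} := by
    ext T; simp [returning]
  rw [h]
  refine isOpen_iUnion fun t => isOpen_iUnion fun _ => isOpen_biInter_finset fun i _ => ?_
  exact isOpen_lt ((continuous_eval t (x i)).sub continuous_const).norm continuous_const

omit [CompleteSpace H] in
-- Each `x i` is tested for all `n ≥ i`, and isometry extends the convergence from the dense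
-- sequence to all vectors.
theorem IsIsometric.isRigid_of_returning {T : C0Semigroup H} (hT : T.IsIsometric) {x : ℕ → H}
    (hx : DenseRange x) (h : ∀ n, T ∈ returning x n) : T.IsRigid := by
  choose t ht hti using h
  refine ⟨t, tendsto_atTop_mono ht tendsto_natCast_atTop_atTop, fun y => ?_⟩
  rw [Metric.tendsto_atTop]
  intro ε hε
  obtain ⟨i, hi⟩ := hx.exists_dist_lt y (ε := ε / 3) (by positivity)
  obtain ⟨N, hN⟩ := exists_nat_one_div_lt (K := ℝ) (ε := ε / 3) (by positivity)
  refine ⟨max i N, fun n hn => ?_⟩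
  have h1 := hti n i (by simp; omega)
  have h2 : (1 : ℝ) / (n + 1) ≤ 1 / (N + 1) := by
    have : (N : ℝ) ≤ n := by exact_mod_cast (le_max_right i N).trans hn
    gcongr
  have h3 : dist (T.toFun (t n) y) (T.toFun (t n) (x i)) = dist y (x i) :=
    (hT (t n)).dist_eq y (x i)
  have h4 := dist_triangle4 (T.toFun (t n) y) (T.toFun (t n) (x i)) (x i) y
  rw [dist_comm (x i) y, dist_eq_norm (T.toFun (t n) (x i))] at h4
  linarith

end C0Semigroup

omit [CompleteSpace H] in
theorem C0Group.continuous_toC0Semigroup :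
    Continuous (C0Group.toC0Semigroup : C0Group H → C0Semigroup H) := by
  refine continuous_iff_continuousAt.2 fun U => C0Semigroup.tendsto_nhds_iff.2 fun x a => ?_
  have h := C0Group.tendsto_nhds_iff.1 (tendsto_id (x := 𝓝 U)) x 0 a
  rw [Metric.tendstoUniformlyOn_iff] at h ⊢
  exact fun ε hε => (h ε hε).mono fun V hV t ht => hV t ⟨t.2, ht.2⟩

/-! ### Density of the return conditions -/

namespace C0Semigroup

/-- Recurrent unitary groups approximate every isometric semigroup. -/
theorem IsIsometric.exists_returning_near {T : C0Semigroup H} (hT : T.IsIsometric)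
    (F : Finset H) (c : ℝ≥0) {ε : ℝ} (hε : 0 < ε) (x : ℕ → H) (n : ℕ) :
    ∃ U : C0Group H, U.IsUnitary ∧ U.toC0Semigroup ∈ returning x n ∧
      ∀ z ∈ F, ∀ t ≤ c, ‖U.toFun t z - T.toFun t z‖ < ε := by
  classical
  obtain ⟨A, hA, V, hV, hAV⟩ := hT.exists_compression_near F c hε
  refine ⟨C0Group.ofBounded _, C0Group.isUnitary_ofBounded (compression_mem_skewAdjoint hA V),
    ?_, hAV⟩
  obtain ⟨t, ht, htx⟩ := exists_norm_exp_smul_compression_sub_lt hA V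
    ((Finset.range (n + 1)).image x) n (ε := 1 / (n + 1)) (by positivity)
  exact ⟨t, ht, fun i hi => htx _ (Finset.mem_image_of_mem x hi)⟩

theorem dense_returning (x : ℕ → H) (n : ℕ) :
    Dense {T : IsometricC0Semigroup H | T.1 ∈ returning x n} := by
  classical
  intro T
  -- The net is indexed by pairs `(F, k)`: error below `1 / (k + 1)` on `F` up to time `k`.
  choose U hU hUx hUT using fun p : Finset H × ℕ =>
    T.2.exists_returning_near p.1 p.2 (Nat.one_div_pos_of_nat (α := ℝ) (n := p.2)) x n
  refine mem_closure_of_tendsto (b := (atTop : Filter (Finset H × ℕ)))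
    (f := fun p => ⟨(U p).toC0Semigroup, (hU p).isIsometric⟩) ?_ (Eventually.of_forall hUx)
  rw [tendsto_subtype_rng, tendsto_nhds_iff]
  intro z a
  rw [Metric.tendstoUniformlyOn_iff]
  intro ε hε
  obtain ⟨N, hN⟩ := exists_nat_one_div_lt hε
  obtain ⟨M, hM⟩ := exists_nat_ge a
  filter_upwards [eventually_ge_atTop (({z} : Finset H), max N M)] with p hp t ht
  have hp2 : max N M ≤ p.2 := hp.2
  have h1 := hUT p z (hp.1 (Finset.mem_singleton_self z)) t
    (ht.2.trans (hM.trans (by exact_mod_cast (le_max_right N M).trans hp2)))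
  rw [dist_comm, dist_eq_norm]
  refine h1.trans (lt_of_le_of_lt ?_ hN)
  have : (N : ℝ) ≤ p.2 := by exact_mod_cast (le_max_left N M).trans hp2
  gcongr

end C0Semigroup

namespace C0Group

/-- For unitary groups, closeness on `[0, 2c]` on the orbit of `U (-c) z` gives closeness on
`[-c, c]` at `z`. -/
theorem IsUnitary.norm_sub_lt_two_mul {U V : C0Group H} (hV : V.IsUnitary) {c ε : ℝ} {z : H}
    (hc : 0 ≤ c) (h : ∀ t ∈ Set.Icc 0 (2 * c),
      ‖V.toFun t (U.toFun (-c) z) - U.toFun t (U.toFun (-c) z)‖ < ε) {t : ℝ}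
    (ht : t ∈ Set.Icc (-c) c) : ‖V.toFun t z - U.toFun t z‖ < 2 * ε := by
  have hUadd : ∀ s t y, U.toFun (s + t) y = U.toFun s (U.toFun t y) := fun s t y => by
    rw [U.map_add']; rfl
  have hVadd : ∀ s t y, V.toFun (s + t) y = V.toFun s (V.toFun t y) := fun s t y => by
    rw [V.map_add']; rfl
  set w := U.toFun (-c) z
  have h1 := h c ⟨hc, by linarith⟩
  -- Since `z = U(c) w`, the error at `z` splits into `V(t) (V(c) w - z)` and the error at `w` at
  -- time `t + c`.
  have h2 := h (t + c) ⟨by linarith [ht.1], by linarith [ht.2]⟩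
  have h3 : U.toFun c w = z := by
    rw [← hUadd, add_neg_cancel, U.map_zero']; rfl
  rw [hVadd, hUadd, h3] at h2
  rw [h3, ← norm_apply_of_mem_unitary (hV t), map_sub, norm_sub_rev] at h1
  have h4 := norm_sub_le_norm_sub_add_norm_sub (V.toFun t z) (V.toFun t (V.toFun c w))
    (U.toFun t z)
  linarith

theorem dense_returning (x : ℕ → H) (n : ℕ) :
    Dense {U : UnitaryC0Group H | U.1.toC0Semigroup ∈ C0Semigroup.returning x n} := by
  classical
  intro U
  choose V hV hVx hVU using fun p : Finset H × ℕ =>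
    (IsUnitary.isIsometric U.2).exists_returning_near (p.1.image (U.1.toFun (-p.2)))
      (2 * p.2) (Nat.one_div_pos_of_nat (α := ℝ) (n := p.2)) x n
  refine mem_closure_of_tendsto (b := (atTop : Filter (Finset H × ℕ)))
    (f := fun p => ⟨V p, hV p⟩) ?_ (Eventually.of_forall hVx)
  rw [tendsto_subtype_rng, tendsto_nhds_iff]
  intro z a b
  rw [Metric.tendstoUniformlyOn_iff]
  intro ε hε
  -- Passing to two-sided intervals doubles the error.
  obtain ⟨N, hN⟩ := exists_nat_one_div_lt (half_pos hε)
  obtain ⟨M, hM⟩ := exists_nat_ge (max (-a) b)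
  filter_upwards [eventually_ge_atTop (({z} : Finset H), max N M)] with p hp t ht
  have hp2 : max N M ≤ p.2 := hp.2
  have hpM : (M : ℝ) ≤ p.2 := by exact_mod_cast (le_max_right N M).trans hp2
  have hpN : (N : ℝ) ≤ p.2 := by exact_mod_cast (le_max_left N M).trans hp2
  have ha := (le_max_left (-a) b).trans (hM.trans hpM)
  have hb := (le_max_right (-a) b).trans (hM.trans hpM)
  have h1 := (hV p).norm_sub_lt_two_mul (U := U.1) (c := p.2) (z := z)
    (ε := 1 / (p.2 + 1)) (Nat.cast_nonneg _)
    (fun s hs => by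
      have h := hVU p _ (Finset.mem_image_of_mem _ (hp.1 (Finset.mem_singleton_self z)))
        s.toNNReal (Real.toNNReal_le_iff_le_coe.2 (by simpa using hs.2))
      simpa [toC0Semigroup, Real.coe_toNNReal s hs.1] using h)
    (t := t) ⟨by linarith [ht.1], by linarith [ht.2]⟩
  rw [dist_comm, dist_eq_norm]
  have h2 : (1 : ℝ) / (p.2 + 1) ≤ 1 / (N + 1) := by gcongr
  linarith

end C0Group

end

theorem mainTheorem4 (H : Type*) [NormedAddCommGroup H] [InnerProductSpace ℂ H] [CompleteSpace H]
    [TopologicalSpace.SeparableSpace H] (hH : ¬ FiniteDimensional ℂ H) :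
    {T : IsometricC0Semigroup H | T.1.IsRigid} ∈ residual (IsometricC0Semigroup H) ∧
    {U : UnitaryC0Group H | U.1.IsRigid} ∈ residual (UnitaryC0Group H) := by
  have hx := TopologicalSpace.denseRange_denseSeq H
  set x := TopologicalSpace.denseSeq H
  constructor
  · have h : ∀ n, {T : IsometricC0Semigroup H | T.1 ∈ C0Semigroup.returning x n} ∈
        residual (IsometricC0Semigroup H) := fun n =>
      residual_of_dense_open ((C0Semigroup.isOpen_returning x n).preimage continuous_subtype_val)
        (C0Semigroup.dense_returning x n)
    filter_upwards [eventually_countable_forall.2 h] with T hT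
    exact T.2.isRigid_of_returning hx hT
  · have h : ∀ n, {U : UnitaryC0Group H | U.1.toC0Semigroup ∈ C0Semigroup.returning x n} ∈
        residual (UnitaryC0Group H) := fun n =>
      residual_of_dense_open ((C0Semigroup.isOpen_returning x n).preimage
        (C0Group.continuous_toC0Semigroup.comp continuous_subtype_val))
        (C0Group.dense_returning x n)
    filter_upwards [eventually_countable_forall.2 h] with U hU
    exact (C0Group.IsUnitary.isIsometric U.2).isRigid_of_returning hx hU
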